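/- **Theorem 2.10 (Explicit formula for the curvature of planar elasticae).** For a smooth curve $\gamma:[a,b]\to\mathbf{R}^n$ ($C^\infty$ with $\gamma'\neq0$ on $[a,b]$), write $\partial_s\psi=\psi_s:=\psi'/|\gamma'|$ for the arclength derivative along $\gamma$. For $\lambda\in\mathbf{R}$, the curve $\gamma$ is called a $\lambda$-elastica if $$2\gamma_{ssss}+6\langle\gamma_{ss},\gamma_{sss}\rangle\gamma_s+3|\gamma_{ss}|^2\gamma_{ss}-\lambda\gamma_{ss}=0\quad\text{on }[a,b].$$ For $n=2$ its signed curvature is $k:=\langle\gamma_{ss},N\rangle$, where $N$ is the counterclockwise rotation of the unit tangent $\gamma_s$ through the angle $\pi/2$. For $m\in[0,1)$ let $F(x,m):=\int_0^x\frac{d\theta}{\sqrt{1-m\sin^2\theta}}$, let $\operatorname{am}(\cdot,m):\mathbf{R}\to\mathbf{R}$ be the inverse function of $F(\cdot,m)$, and put $\operatorname{cn}(x,m):=\cos(\operatorname{am}(x,m))$ and $\operatorname{dn}(x,m):=\sqrt{1-m\sin^2(\operatorname{am}(x,m))}$; also $\operatorname{sech}x:=1/\cosh x$. Let $\lambda\in\mathbf{R}$,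 $L>0$, and let $\gamma:[0,L]\to\mathbf{R}^2$ be an arclength parametrized (i.e. $|\gamma'|\equiv1$) $\lambda$-elastica. Then its signed curvature $k$ is given on $[0,L]$ by one of the following forms, where the sign $\pm$ is the same for all $s\in[0,L]$: 1. $k(s)=0$; 2. $k(s)=\pm A\operatorname{cn}(\alpha s+\beta,m)$ for some $A>0$, $\alpha>0$, $\beta\in\mathbf{R}$, $m\in(0,1)$ such that $A^2=4\alpha^2m$ and $2m\lambda=A^2(2m-1)$; 3. $k(s)=\pm A\operatorname{sech}(\alpha s+\beta)$ for some $A>0$, $\alpha>0$, $\beta\in\mathbf{R}$ such that $A^2=4\alpha^2=2\lambda$; 4. $k(s)=\pm A\operatorname{dn}(\alpha s+\beta,m)$ for some $A>0$, $\alpha>0$, $\beta\in\mathbf{R}$, $m\in(0,1)$ such that $A^2=4\alpha^2$ and $2\lambda=A^2(2-m)$; 5. $k(s)=\pm\sqrt{\lambda}$, where $\lambda>0$. -/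

import Mathlib

open scoped ContDiff

noncomputable section

/-- The arclength derivative `∂ₛψ = |γ'|⁻¹ ψ'` along a curve `γ : [a,b] → ℝⁿ`. Derivatives are taken
within the closed interval `[a,b]`, hence one-sided at the end points. -/
def arcDeriv {n : ℕ} (γ : ℝ → EuclideanSpace ℝ (Fin n)) (a b : ℝ)
    (ψ : ℝ → EuclideanSpace ℝ (Fin n)) (x : ℝ) : EuclideanSpace ℝ (Fin n) :=
  ‖derivWithin γ (Set.Icc a b) x‖⁻¹ • derivWithin ψ (Set.Icc a b) x

/-- The `j`-th arclength derivative `∂ₛʲγ` of the curve `γ : [a,b] → ℝⁿ` itself. -/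
def arcIter {n : ℕ} (γ : ℝ → EuclideanSpace ℝ (Fin n)) (a b : ℝ) (j : ℕ) :
    ℝ → EuclideanSpace ℝ (Fin n) :=
  (arcDeriv γ a b)^[j] γ

/-- `γ : [a,b] → ℝⁿ` is a smooth curve: a `C^∞` map on `[a,b]` with non-vanishing derivative. -/
structure IsSmoothCurve {n : ℕ} (γ : ℝ → EuclideanSpace ℝ (Fin n)) (a b : ℝ) : Prop where
  contDiffOn : ContDiffOn ℝ ∞ γ (Set.Icc a b)
  deriv_ne_zero : ∀ x ∈ Set.Icc a b, derivWithin γ (Set.Icc a b) x ≠ 0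

/-- `γ : [a,b] → ℝⁿ` is a `lam`-elastica: a smooth curve solving
`2 γ_ssss + 6 ⟨γ_ss, γ_sss⟩ γ_s + 3 |γ_ss|² γ_ss - lam γ_ss = 0` on `[a,b]`. -/
structure IsElastica {n : ℕ} (lam : ℝ) (γ : ℝ → EuclideanSpace ℝ (Fin n)) (a b : ℝ) : Prop where
  smooth : IsSmoothCurve γ a b
  equation : ∀ x ∈ Set.Icc a b,
    (2 : ℝ) • arcIter γ a b 4 x
      + (6 * inner ℝ (arcIter γ a b 2 x) (arcIter γ a b 3 x)) • arcIter γ a b 1 x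
      + (3 * ‖arcIter γ a b 2 x‖ ^ 2) • arcIter γ a b 2 x
      - lam • arcIter γ a b 2 x = 0

/-- `γ : [a,b] → ℝⁿ` is parametrized by arclength. -/
def IsArclength {n : ℕ} (γ : ℝ → EuclideanSpace ℝ (Fin n)) (a b : ℝ) : Prop :=
  ∀ x ∈ Set.Icc a b, ‖derivWithin γ (Set.Icc a b) x‖ = 1

/-- Counterclockwise rotation of the plane through the angle `π/2`. -/
def rotQuarter (v : EuclideanSpace ℝ (Fin 2)) : EuclideanSpace ℝ (Fin 2) :=
  !₂[-(v 1), v 0]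

/-- The signed curvature `k = ⟨γ_ss, N⟩`, `N = rotQuarter γ_s`, of a curve `γ : [a,b] → ℝ²`. -/
def signedCurvature (γ : ℝ → EuclideanSpace ℝ (Fin 2)) (a b : ℝ) (x : ℝ) : ℝ :=
  inner ℝ (arcIter γ a b 2 x) (rotQuarter (arcIter γ a b 1 x))

/-- The incomplete elliptic integral of the first kind with parameter `m`. -/
def ellipticF (x m : ℝ) : ℝ :=
  ∫ θ in (0 : ℝ)..x, 1 / Real.sqrt (1 - m * Real.sin θ ^ 2)

/-- The Jacobi amplitude: for `m ∈ [0,1)`, the map `ellipticF · m` is a bijection of `ℝ`, and the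
amplitude is its inverse. -/
def jacobiAm (x m : ℝ) : ℝ :=
  Function.invFun (fun y => ellipticF y m) x

/-- The hyperbolic secant. -/
def hypSech (x : ℝ) : ℝ := 1 / Real.cosh x

/-- The Jacobi elliptic cosine with parameter `m ∈ [0,1]`. -/
def jacobiCn (x m : ℝ) : ℝ :=
  if m = 1 then hypSech x else Real.cos (jacobiAm x m)

/-- The Jacobi elliptic delta with parameter `m ∈ [0,1]`. -/
def jacobiDn (x m : ℝ) : ℝ :=
  if m = 1 then hypSech x else Real.sqrt (1 - m * Real.sin (jacobiAm x m) ^ 2)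

end

/-! ### The Jacobi amplitude -/

/-! Pairing the elastica equation with the normal gives `2k'' = lam k - k³`
(`IsElastica.isCurvatureSol`). Its energy `C = 4k'² + k⁴ - 2 lam k²` is a first integral: with `D² =
lam² + C` it reads `4k'² = D² - (k² - lam)²`, so `k²` turns at `lam ± D`. If `C > 0`, then `lam - D
< 0`, `k` can cross zero and is a `cn`; if `C < 0`, `k` keeps its sign and is a `dn`, or constant
when `D = 0`; `C = 0` gives `sech` or zero. Conservation itself is never needed. Amplitude and
modulus are read off from `C` at `s = 0`, a phase matching `(k, k')` at `0` is found
(`exists_phase_cn`, `exists_phase_dn`, `exists_phase_sech`), and ODE uniqueness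
(`IsCurvatureSol.eqOn`) does the rest. -/

lemma one_sub_mul_sin_sq_pos {m : ℝ} (hm : m < 1) (x : ℝ) :
    0 < 1 - m * Real.sin x ^ 2 := by
  have h := Real.sin_sq_le_one x
  rcases le_total m 0 with h0 | h0
  · linarith [mul_nonneg (neg_nonneg.2 h0) (sq_nonneg (Real.sin x))]
  · linarith [mul_le_mul_of_nonneg_left h h0]

lemma hasDerivAt_ellipticF {m : ℝ} (hm : m < 1) (x : ℝ) :
    HasDerivAt (fun y => ellipticF y m) (1 / Real.sqrt (1 - m * Real.sin x ^ 2)) x := by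
  have hc : Continuous fun θ : ℝ => 1 / Real.sqrt (1 - m * Real.sin θ ^ 2) :=
    continuous_const.div (by fun_prop)
      fun θ => (Real.sqrt_pos.2 (one_sub_mul_sin_sq_pos hm θ)).ne'
  exact intervalIntegral.integral_hasDerivAt_right (hc.intervalIntegrable _ _)
    (hc.stronglyMeasurableAtFilter _ _) hc.continuousAt

lemma strictMono_ellipticF {m : ℝ} (hm : m < 1) : StrictMono fun y => ellipticF y m :=
  strictMono_of_hasDerivAt_pos (fun x => hasDerivAt_ellipticF hm x)
    fun x => one_div_pos.2 (Real.sqrt_pos.2 (one_sub_mul_sin_sq_pos hm x))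

/-- For `m ≥ 0` the integrand is at least `1`. This linear growth makes `ellipticF · m` surjective.
-/
lemma monotone_ellipticF_sub_id {m : ℝ} (hm0 : 0 ≤ m) (hm : m < 1) :
    Monotone fun y => ellipticF y m - y := by
  have hd (x : ℝ) := (hasDerivAt_ellipticF hm x).sub (hasDerivAt_id x)
  refine monotone_of_deriv_nonneg (fun x => (hd x).differentiableAt) fun x => ?_
  refine (hd x).deriv.symm ▸ sub_nonneg.2 ?_
  rw [le_div_iff₀ (Real.sqrt_pos.2 (one_sub_mul_sin_sq_pos hm x)), one_mul]
  exact Real.sqrt_le_one.2 (by nlinarith [mul_nonneg hm0 (sq_nonneg (Real.sin x))])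

lemma surjective_ellipticF {m : ℝ} (hm0 : 0 ≤ m) (hm : m < 1) :
    Function.Surjective fun y => ellipticF y m := by
  have h0 : ellipticF 0 m = 0 := by simp [ellipticF]
  have hcont : Continuous fun y => ellipticF y m :=
    continuous_iff_continuousAt.2 fun x => (hasDerivAt_ellipticF hm x).continuousAt
  refine hcont.surjective ?_ ?_
  · refine Filter.tendsto_atTop_mono' _ ?_ Filter.tendsto_id
    filter_upwards [Filter.eventually_ge_atTop 0] with x hx
    have := monotone_ellipticF_sub_id hm0 hm hx
    simp only [h0, id] at this ⊢
    linarith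
  · refine Filter.tendsto_atBot_mono' _ ?_ Filter.tendsto_id
    filter_upwards [Filter.eventually_le_atBot 0] with x hx
    have := monotone_ellipticF_sub_id hm0 hm hx
    simp only [h0, id] at this ⊢
    linarith

lemma jacobiAm_ellipticF {m : ℝ} (hm : m < 1) (x : ℝ) : jacobiAm (ellipticF x m) m = x :=
  Function.leftInverse_invFun (strictMono_ellipticF hm).injective x

lemma ellipticF_jacobiAm {m : ℝ} (hm0 : 0 ≤ m) (hm : m < 1) (x : ℝ) :
    ellipticF (jacobiAm x m) m = x :=
  Function.rightInverse_invFun (surjective_ellipticF hm0 hm) x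

lemma continuous_jacobiAm {m : ℝ} (hm0 : 0 ≤ m) (hm : m < 1) :
    Continuous fun x => jacobiAm x m := by
  refine Monotone.continuous_of_surjective (fun x y hxy => ?_)
    fun x => ⟨_, jacobiAm_ellipticF hm x⟩
  refine (strictMono_ellipticF hm).le_iff_le.1 ?_
  simpa only [ellipticF_jacobiAm hm0 hm] using hxy

lemma hasDerivAt_jacobiAm {m : ℝ} (hm0 : 0 ≤ m) (hm : m < 1) (x : ℝ) :
    HasDerivAt (fun x => jacobiAm x m)
      (Real.sqrt (1 - m * Real.sin (jacobiAm x m) ^ 2)) x := by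
  have h := HasDerivAt.of_local_left_inverse (continuous_jacobiAm hm0 hm).continuousAt
    (hasDerivAt_ellipticF hm (jacobiAm x m))
    (one_div_pos.2 (Real.sqrt_pos.2 (one_sub_mul_sin_sq_pos hm _))).ne'
    (Filter.Eventually.of_forall fun y => ellipticF_jacobiAm hm0 hm y)
  simpa using h

lemma hasDerivAt_jacobiAm_affine {m : ℝ} (hm0 : 0 ≤ m) (hm : m < 1) (α β s : ℝ) :
    HasDerivAt (fun s => jacobiAm (α * s + β) m)
      (α * jacobiDn (α * s + β) m) s := by
  have h1 : HasDerivAt (fun s => α * s + β) α s := by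
    simpa using ((hasDerivAt_id s).const_mul α).add_const β
  have h2 := (hasDerivAt_jacobiAm hm0 hm (α * s + β)).comp s h1
  rw [jacobiDn, if_neg hm.ne, mul_comm]
  exact h2

lemma jacobiDn_pos {m : ℝ} (hm : m < 1) (x : ℝ) : 0 < jacobiDn x m := by
  rw [jacobiDn, if_neg hm.ne]
  exact Real.sqrt_pos.2 (one_sub_mul_sin_sq_pos hm _)

lemma jacobiDn_sq {m : ℝ} (hm : m < 1) (x : ℝ) :
    jacobiDn x m ^ 2 = 1 - m * Real.sin (jacobiAm x m) ^ 2 := by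
  rw [jacobiDn, if_neg hm.ne, Real.sq_sqrt (one_sub_mul_sin_sq_pos hm _).le]

lemma jacobiCn_eq {m : ℝ} (hm : m < 1) (x : ℝ) : jacobiCn x m = Real.cos (jacobiAm x m) := by
  rw [jacobiCn, if_neg hm.ne]

lemma hasDerivAt_jacobiDn_affine {m : ℝ} (hm0 : 0 ≤ m) (hm : m < 1) (α β s : ℝ) :
    HasDerivAt (fun s => jacobiDn (α * s + β) m)
      (-(m * α * Real.sin (jacobiAm (α * s + β) m) * Real.cos (jacobiAm (α * s + β) m))) s := by
  have h := ((((hasDerivAt_jacobiAm_affine hm0 hm α β s).sin.fun_pow 2).const_mul m).const_sub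
    1).sqrt (one_sub_mul_sin_sq_pos hm _).ne'
  have hp := jacobiDn_pos hm (α * s + β)
  simp only [jacobiDn, if_neg hm.ne] at h hp ⊢
  refine h.congr_deriv ?_
  field_simp
  ring

/-! ### The curvature equation `2 u'' = lam u - u ^ 3` -/

/-- `u` solves `2 u'' = lam u - u ^ 3` on `S`, with derivative `v`. -/
structure IsCurvatureSol (lam : ℝ) (u v : ℝ → ℝ) (S : Set ℝ) : Prop where
  hasDeriv : ∀ s ∈ S, HasDerivWithinAt u (v s) S s
  hasDeriv_deriv : ∀ s ∈ S, HasDerivWithinAt v ((lam * u s - u s ^ 3) / 2) S s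

lemma IsCurvatureSol.eqOn {lam L : ℝ} {u v u' v' : ℝ → ℝ}
    (h : IsCurvatureSol lam u v (Set.Icc 0 L)) (h' : IsCurvatureSol lam u' v' (Set.Icc 0 L))
    (hu : u 0 = u' 0) (hv : v 0 = v' 0) : Set.EqOn u u' (Set.Icc 0 L) := by
  set X : ℝ × ℝ → ℝ × ℝ := fun p => (p.2, (lam * p.1 - p.1 ^ 3) / 2) with hX
  have hXs : ContDiff ℝ 1 X := by fun_prop
  have hder {u v : ℝ → ℝ} (h : IsCurvatureSol lam u v (Set.Icc 0 L)) :
      ∀ s ∈ Set.Icc 0 L,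
        HasDerivWithinAt (fun s => (u s, v s)) (X (u s, v s)) (Set.Icc 0 L) s :=
    fun s hs => (h.hasDeriv s hs).prodMk (h.hasDeriv_deriv s hs)
  have hcont {u v : ℝ → ℝ} (h : IsCurvatureSol lam u v (Set.Icc 0 L)) :
      ContinuousOn (fun s => (u s, v s)) (Set.Icc 0 L) :=
    fun s hs => (hder h s hs).continuousWithinAt
  have hK := (isCompact_Icc.image_of_continuousOn (hcont h)).union
    (isCompact_Icc.image_of_continuousOn (hcont h'))
  -- The cubic field is not globally Lipschitz, but it is on the compact union of the two
  -- trajectories.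
  obtain ⟨K, hLip⟩ := hXs.locallyLipschitz.locallyLipschitzOn.exists_lipschitzOnWith_of_compact hK
  have hright {u v : ℝ → ℝ} (h : IsCurvatureSol lam u v (Set.Icc 0 L)) :
      ∀ s ∈ Set.Ico 0 L,
        HasDerivWithinAt (fun s => (u s, v s)) (X (u s, v s)) (Set.Ici s) s := fun s hs =>
    (hder h s (Set.Ico_subset_Icc_self hs)).mono_of_mem_nhdsWithin (Icc_mem_nhdsGE_of_mem hs)
  have key := ODE_solution_unique_of_mem_Icc_right (v := fun _ => X) (fun _ _ => hLip) (hcont h)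
    (hright h) (fun s hs => Or.inl ⟨s, Set.Ico_subset_Icc_self hs, rfl⟩) (hcont h')
    (hright h') (fun s hs => Or.inr ⟨s, Set.Ico_subset_Icc_self hs, rfl⟩)
    (by simp only [hu, hv])
  exact fun s hs => congrArg Prod.fst (key hs)

lemma isCurvatureSol_const {lam c : ℝ} (hc : lam * c = c ^ 3) (S : Set ℝ) :
    IsCurvatureSol lam (fun _ => c) (fun _ => 0) S where
  hasDeriv s _ := hasDerivWithinAt_const ..
  hasDeriv_deriv s _ := by
    simpa [hc] using hasDerivWithinAt_const s S (0 : ℝ)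

lemma isCurvatureSol_cn {lam A α m : ℝ} (hm0 : 0 < m) (hm : m < 1)
    (hA : A ^ 2 = 4 * α ^ 2 * m) (hlam : 2 * m * lam = A ^ 2 * (2 * m - 1)) (β : ℝ) (S : Set ℝ) :
    IsCurvatureSol lam (fun s => A * jacobiCn (α * s + β) m)
      (fun s => -(A * α * Real.sin (jacobiAm (α * s + β) m) * jacobiDn (α * s + β) m)) S where
  hasDeriv s _ := by
    have h := ((hasDerivAt_jacobiAm_affine hm0.le hm α β s).cos.const_mul A).hasDerivWithinAt
      (s := S)
    simp only [jacobiCn_eq hm]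
    exact h.congr_deriv (by ring)
  hasDeriv_deriv s _ := by
    have h := (((hasDerivAt_jacobiAm_affine hm0.le hm α β s).sin.const_mul (A * α)).mul
      (hasDerivAt_jacobiDn_affine hm0.le hm α β s)).neg.hasDerivWithinAt (s := S)
    refine h.congr_deriv ?_
    have hlam' : lam = 2 * α ^ 2 * (2 * m - 1) := by
      rw [hA] at hlam
      exact mul_left_cancel₀ (mul_pos two_pos hm0).ne' (by linarith)
    have hd := jacobiDn_sq hm (α * s + β)
    have hs := Real.sin_sq_add_cos_sq (jacobiAm (α * s + β) m)
    rw [jacobiCn_eq hm]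
    set c := Real.cos (jacobiAm (α * s + β) m)
    set t := Real.sin (jacobiAm (α * s + β) m)
    set d := jacobiDn (α * s + β) m
    rw [hlam']
    linear_combination (-A * α ^ 2 * c) * hd + 2 * m * A * α ^ 2 * c * hs + A * c ^ 3 / 2 * hA

lemma isCurvatureSol_dn {lam σ A α m : ℝ} (hσ : σ ^ 2 = 1) (hm0 : 0 < m) (hm : m < 1)
    (hA : A ^ 2 = 4 * α ^ 2) (hlam : 2 * lam = A ^ 2 * (2 - m)) (β : ℝ) (S : Set ℝ) :
    IsCurvatureSol lam (fun s => σ * (A * jacobiDn (α * s + β) m))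
      (fun s => -(σ * A * m * α * Real.sin (jacobiAm (α * s + β) m) *
        Real.cos (jacobiAm (α * s + β) m))) S where
  hasDeriv s _ := by
    have h := (((hasDerivAt_jacobiDn_affine hm0.le hm α β s).const_mul A).const_mul
      σ).hasDerivWithinAt (s := S)
    exact h.congr_deriv (by ring)
  hasDeriv_deriv s _ := by
    have h := (((hasDerivAt_jacobiAm_affine hm0.le hm α β s).sin.const_mul (σ * A * m * α)).mul
      (hasDerivAt_jacobiAm_affine hm0.le hm α β s).cos).neg.hasDerivWithinAt (s := S)
    refine h.congr_deriv ?_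
    have hlam' : lam = 2 * α ^ 2 * (2 - m) := by
      rw [hA] at hlam
      linarith
    have hd := jacobiDn_sq hm (α * s + β)
    have hs := Real.sin_sq_add_cos_sq (jacobiAm (α * s + β) m)
    set c := Real.cos (jacobiAm (α * s + β) m)
    set t := Real.sin (jacobiAm (α * s + β) m)
    set d := jacobiDn (α * s + β) m
    rw [hlam']
    linear_combination 2 * σ * A * α ^ 2 * d * hd - m * σ * A * α ^ 2 * d * hs +
      σ * A * d ^ 3 / 2 * hA + σ * A ^ 3 * d ^ 3 / 2 * hσ

lemma isCurvatureSol_sech {lam σ A α : ℝ} (hσ : σ ^ 2 = 1)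
    (hA : A ^ 2 = 4 * α ^ 2) (hlam : A ^ 2 = 2 * lam) (β : ℝ) (S : Set ℝ) :
    IsCurvatureSol lam (fun s => σ * (A * hypSech (α * s + β)))
      (fun s => -(σ * A * α * Real.sinh (α * s + β) / Real.cosh (α * s + β) ^ 2)) S where
  hasDeriv s _ := by
    have h1 : HasDerivAt (fun s => α * s + β) α s := by
      simpa using ((hasDerivAt_id s).const_mul α).add_const β
    have hc := (Real.cosh_pos (α * s + β)).ne'
    have h := (((h1.cosh.fun_inv hc).const_mul A).const_mul σ).hasDerivWithinAt (s := S)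
    simp only [hypSech, one_div]
    exact h.congr_deriv (by ring)
  hasDeriv_deriv s _ := by
    have h1 : HasDerivAt (fun s => α * s + β) α s := by
      simpa using ((hasDerivAt_id s).const_mul α).add_const β
    have hc := (Real.cosh_pos (α * s + β)).ne'
    have h := ((h1.sinh.const_mul (σ * A * α)).div (h1.cosh.fun_pow 2)
      (pow_ne_zero 2 hc)).neg.hasDerivWithinAt (s := S)
    refine h.congr_deriv ?_
    have hlam' : lam = 2 * α ^ 2 := by linarith
    have hs := Real.cosh_sq_sub_sinh_sq (α * s + β)
    rw [hypSech]
    generalize Real.cosh (α * s + β) = c at *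
    generalize Real.sinh (α * s + β) = t at *
    rw [hlam']
    field_simp
    push_cast
    rw [hσ, hA]
    linear_combination (-4 * σ * A * α ^ 2 * c) * hs

/-! ### Matching initial data -/

/-- `hy` is the energy relation: once `cos φ = x / A`, it determines `y` up to sign. Replacing `φ`
by `-φ` flips `y` and keeps `x`, so `ellipticF (±φ) m` is the phase. -/
lemma exists_phase_cn {x y A α m : ℝ} (hA0 : 0 < A) (hm : m < 1)
    (hA : A ^ 2 = 4 * α ^ 2 * m) (hx : x ^ 2 ≤ A ^ 2)
    (hy : 4 * y ^ 2 = (A ^ 2 - x ^ 2) * (4 * α ^ 2 * (1 - m) + x ^ 2)) :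
    ∃ β, A * jacobiCn β m = x ∧
      -(A * α * Real.sin (jacobiAm β m) * jacobiDn β m) = y := by
  obtain ⟨φ, hφ⟩ : ∃ φ, A * Real.cos φ = x := by
    obtain ⟨h1, h2⟩ := abs_le.1 (sq_le_sq.1 hx |>.trans_eq (abs_of_pos hA0))
    refine ⟨Real.arccos (x / A), ?_⟩
    rw [Real.cos_arccos (by rw [le_div_iff₀ hA0]; linarith) (by rw [div_le_iff₀ hA0]; linarith)]
    field_simp
  have hsq : y ^ 2 = (A * α * Real.sin φ * jacobiDn (ellipticF φ m) m) ^ 2 := by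
    rw [mul_pow, jacobiDn_sq hm, jacobiAm_ellipticF hm, mul_pow, Real.sin_sq]
    rw [← hφ] at hy
    linear_combination hy / 4 + A ^ 2 * Real.cos φ ^ 2 * (1 - Real.cos φ ^ 2) / 4 * hA
  rcases sq_eq_sq_iff_eq_or_eq_neg.1 hsq with h | h
  · refine ⟨ellipticF (-φ) m, ?_, ?_⟩
    · rw [jacobiCn_eq hm, jacobiAm_ellipticF hm, Real.cos_neg, hφ]
    · rw [h, jacobiDn, jacobiDn, if_neg hm.ne, if_neg hm.ne, jacobiAm_ellipticF hm,
        jacobiAm_ellipticF hm, Real.sin_neg, neg_sq]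
      ring
  · refine ⟨ellipticF φ m, ?_, ?_⟩
    · rw [jacobiCn_eq hm, jacobiAm_ellipticF hm, hφ]
    · rw [h, jacobiAm_ellipticF hm]

/-- As for `cn`, now with `sin² φ = (A² - x²) / (A² m)`, which the bounds on `x²` place in `[0, 1]`.
Since `dn` is positive, `x` must be nonnegative; signs are restored later by `σ`. -/
lemma exists_phase_dn {x y A α m : ℝ} (hA0 : 0 < A) (hm0 : 0 < m) (hm : m < 1)
    (hA : A ^ 2 = 4 * α ^ 2) (hx : x ^ 2 ≤ A ^ 2) (hx' : A ^ 2 * (1 - m) ≤ x ^ 2)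
    (hx0 : 0 ≤ x) (hy : 4 * y ^ 2 = (A ^ 2 - x ^ 2) * (x ^ 2 - A ^ 2 * (1 - m))) :
    ∃ β, A * jacobiDn β m = x ∧
      -(A * m * α * Real.sin (jacobiAm β m) * Real.cos (jacobiAm β m)) = y := by
  obtain ⟨φ, hφ⟩ : ∃ φ, A ^ 2 * m * Real.sin φ ^ 2 = A ^ 2 - x ^ 2 := by
    have hAm : 0 < A ^ 2 * m := by positivity
    have h0 : 0 ≤ (A ^ 2 - x ^ 2) / (A ^ 2 * m) := div_nonneg (by linarith) hAm.le
    have h1 : (A ^ 2 - x ^ 2) / (A ^ 2 * m) ≤ 1 := (div_le_one hAm).2 (by linarith)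
    refine ⟨Real.arcsin (Real.sqrt ((A ^ 2 - x ^ 2) / (A ^ 2 * m))), ?_⟩
    rw [Real.sin_arcsin (by linarith [Real.sqrt_nonneg ((A ^ 2 - x ^ 2) / (A ^ 2 * m))])
      (Real.sqrt_le_one.2 h1), Real.sq_sqrt h0]
    field_simp
  have hdn : A * Real.sqrt (1 - m * Real.sin φ ^ 2) = x := by
    refine (sq_eq_sq₀ (by positivity) hx0).1 ?_
    rw [mul_pow, Real.sq_sqrt (one_sub_mul_sin_sq_pos hm φ).le]
    linarith
  have hsq : y ^ 2 = (A * m * α * Real.sin φ * Real.cos φ) ^ 2 := by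
    have hc := Real.cos_sq' φ
    have hx2 : x ^ 2 = A ^ 2 - A ^ 2 * m * Real.sin φ ^ 2 := by linarith
    rw [hx2] at hy
    rw [mul_pow, hc]
    linear_combination hy / 4 +
      A ^ 2 * m ^ 2 * Real.sin φ ^ 2 * (1 - Real.sin φ ^ 2) / 4 * hA
  rcases sq_eq_sq_iff_eq_or_eq_neg.1 hsq with h | h
  · refine ⟨ellipticF (-φ) m, ?_, ?_⟩
    · rw [jacobiDn, if_neg hm.ne, jacobiAm_ellipticF hm, Real.sin_neg, neg_sq, hdn]
    · rw [h, jacobiAm_ellipticF hm, Real.sin_neg, Real.cos_neg]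
      ring
  · refine ⟨ellipticF φ m, ?_, ?_⟩
    · rw [jacobiDn, if_neg hm.ne, jacobiAm_ellipticF hm, hdn]
    · rw [h, jacobiAm_ellipticF hm]

lemma exists_phase_sech {x y A α : ℝ} (hA0 : 0 < A) (hx0 : 0 < x)
    (hA : A ^ 2 = 4 * α ^ 2) (hx : x ^ 2 ≤ A ^ 2)
    (hy : 4 * y ^ 2 = x ^ 2 * (A ^ 2 - x ^ 2)) :
    ∃ β, A * hypSech β = x ∧ -(A * α * Real.sinh β / Real.cosh β ^ 2) = y := by
  have h1 : 1 ≤ A / x := (one_le_div hx0).2 (abs_le_of_sq_le_sq' hx hA0.le).2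
  obtain ⟨φ, hφ⟩ : ∃ φ, Real.cosh φ = A / x := ⟨_, Real.cosh_arcosh h1⟩
  have hsq : y ^ 2 = (A * α * Real.sinh φ / Real.cosh φ ^ 2) ^ 2 := by
    have hs : Real.sinh φ ^ 2 = (A / x) ^ 2 - 1 := by rw [Real.sinh_sq, hφ]
    rw [div_pow, mul_pow, hs, hφ, mul_pow]
    field_simp
    linear_combination hy / 4 * A ^ 2 + x ^ 2 * (A ^ 2 - x ^ 2) / 4 * hA
  rcases sq_eq_sq_iff_eq_or_eq_neg.1 hsq with h | h
  · refine ⟨-φ, ?_, ?_⟩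
    · rw [hypSech, Real.cosh_neg, hφ]
      field_simp
    · rw [h, Real.sinh_neg, Real.cosh_neg]
      ring
  · refine ⟨φ, ?_, ?_⟩
    · rw [hypSech, hφ]
      field_simp
    · rw [h]

/-! ### Solutions of the curvature equation -/

/-- Positive energy: the oscillation crosses zero. -/
lemma IsCurvatureSol.exists_cn {lam L : ℝ} {u v : ℝ → ℝ}
    (h : IsCurvatureSol lam u v (Set.Icc 0 L))
    (hC : 0 < 4 * v 0 ^ 2 + u 0 ^ 4 - 2 * lam * u 0 ^ 2) :
    ∃ A α β m : ℝ, 0 < A ∧ 0 < α ∧ 0 < m ∧ m < 1 ∧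
      A ^ 2 = 4 * α ^ 2 * m ∧ 2 * m * lam = A ^ 2 * (2 * m - 1) ∧
      ∀ s ∈ Set.Icc 0 L, u s = A * jacobiCn (α * s + β) m := by
  generalize hx : u 0 = x at hC
  generalize hy : v 0 = y at hC
  -- The parameters are `A² = lam + D`, the maximum of `u²`, `α² = D / 2` and `m = (lam + D) /
  -- (2D)`. Positive energy means `|lam| < D`, hence `0 < m < 1`.
  obtain ⟨D, hD0, hD⟩ : ∃ D, 0 ≤ D ∧ D ^ 2 = lam ^ 2 + (4 * y ^ 2 + x ^ 4 - 2 * lam * x ^ 2) :=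
    ⟨_, Real.sqrt_nonneg _, Real.sq_sqrt (by nlinarith [sq_nonneg lam])⟩
  obtain ⟨hD1, hD2⟩ := abs_lt_of_sq_lt_sq' (by linarith : lam ^ 2 < D ^ 2) hD0
  have hDpos : 0 < D := by linarith
  have hA2 : Real.sqrt (lam + D) ^ 2 = lam + D := Real.sq_sqrt (by linarith)
  have hα2 : Real.sqrt (D / 2) ^ 2 = D / 2 := Real.sq_sqrt (by linarith)
  have hA0 : 0 < Real.sqrt (lam + D) := Real.sqrt_pos.2 (by linarith)
  have hα0 : 0 < Real.sqrt (D / 2) := Real.sqrt_pos.2 (by linarith)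
  have hm0 : 0 < (lam + D) / (2 * D) := div_pos (by linarith) (by linarith)
  have hm1 : (lam + D) / (2 * D) < 1 := (div_lt_one (by linarith)).2 (by linarith)
  have hA : Real.sqrt (lam + D) ^ 2 = 4 * Real.sqrt (D / 2) ^ 2 * ((lam + D) / (2 * D)) := by
    rw [hA2, hα2]
    field_simp
    ring
  have hlam : 2 * ((lam + D) / (2 * D)) * lam =
      Real.sqrt (lam + D) ^ 2 * (2 * ((lam + D) / (2 * D)) - 1) := by
    rw [hA2]
    field_simp
    ring
  have hrange := (abs_le_of_sq_le_sq' (by nlinarith [sq_nonneg y] :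
    (x ^ 2 - lam) ^ 2 ≤ D ^ 2) hD0).2
  obtain ⟨β, hβ, hβ'⟩ := exists_phase_cn hA0 hm1 hA (by linarith : x ^ 2 ≤ _)
    (y := y) (by
      rw [hA2, hα2]
      have : 4 * (D / 2) * (1 - (lam + D) / (2 * D)) = D - lam := by
        field_simp
        ring
      rw [this]
      linear_combination -hD)
  exact ⟨_, _, β, _, hA0, hα0, hm0, hm1, hA, hlam,
    h.eqOn (isCurvatureSol_cn hm0 hm1 hA hlam β _) (by simp [hx, hβ]) (by simp [hy, ← hβ'])⟩

lemma exists_sign_mul_abs (x : ℝ) : ∃ σ : ℝ, (σ = 1 ∨ σ = -1) ∧ x = σ * |x| := by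
  rcases le_total 0 x with h | h
  · exact ⟨1, Or.inl rfl, by rw [abs_of_nonneg h, one_mul]⟩
  · exact ⟨-1, Or.inr rfl, by rw [abs_of_nonpos h]; ring⟩

lemma sign_sq {σ : ℝ} (h : σ = 1 ∨ σ = -1) : σ ^ 2 = 1 := by
  rcases h with rfl | rfl <;> norm_num

/-- Zero energy: the separatrix. -/
lemma IsCurvatureSol.exists_sech {lam L : ℝ} {u v : ℝ → ℝ}
    (h : IsCurvatureSol lam u v (Set.Icc 0 L))
    (hC : 4 * v 0 ^ 2 + u 0 ^ 4 - 2 * lam * u 0 ^ 2 = 0) (hu : u 0 ≠ 0) :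
    ∃ σ A α β : ℝ, (σ = 1 ∨ σ = -1) ∧ 0 < A ∧ 0 < α ∧ A ^ 2 = 4 * α ^ 2 ∧ A ^ 2 = 2 * lam ∧
      ∀ s ∈ Set.Icc 0 L, u s = σ * (A * hypSech (α * s + β)) := by
  have hx2 : 0 < u 0 ^ 2 := by positivity
  have hle : u 0 ^ 2 ≤ 2 * lam := by
    refine le_of_mul_le_mul_left ?_ hx2
    nlinarith [sq_nonneg (v 0)]
  have hlam : 0 < lam := by linarith
  obtain ⟨σ, hσ, hux⟩ := exists_sign_mul_abs (u 0)
  have hσ2 := sign_sq hσ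
  have hA2 : Real.sqrt (2 * lam) ^ 2 = 2 * lam := Real.sq_sqrt (by linarith)
  have hα2 : Real.sqrt (lam / 2) ^ 2 = lam / 2 := Real.sq_sqrt (by linarith)
  have hA0 : 0 < Real.sqrt (2 * lam) := Real.sqrt_pos.2 (by linarith)
  have hα0 : 0 < Real.sqrt (lam / 2) := Real.sqrt_pos.2 (by linarith)
  have hA : Real.sqrt (2 * lam) ^ 2 = 4 * Real.sqrt (lam / 2) ^ 2 := by
    rw [hA2, hα2]
    ring
  -- The equation is odd, so the phase is matched to `σ (u, v)`, whose first entry is `|u 0|`.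
  obtain ⟨β, hβ, hβ'⟩ := exists_phase_sech (y := σ * v 0) hA0 (abs_pos.2 hu) hA
    (by rw [sq_abs, hA2]; exact hle)
    (by rw [sq_abs, hA2]; linear_combination hC + 4 * v 0 ^ 2 * hσ2)
  refine ⟨σ, _, _, β, hσ, hA0, hα0, hA, hA2,
    h.eqOn (isCurvatureSol_sech hσ2 hA hA2 β _) ?_ ?_⟩
  · simpa only [mul_zero, zero_add, hβ] using hux
  · simp only [mul_zero, zero_add]
    linear_combination -σ * hβ' - v 0 * hσ2

/-- Negative energy: the oscillation stays away from zero, or is constant. -/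
lemma IsCurvatureSol.exists_dn {lam L : ℝ} {u v : ℝ → ℝ}
    (h : IsCurvatureSol lam u v (Set.Icc 0 L))
    (hC : 4 * v 0 ^ 2 + u 0 ^ 4 - 2 * lam * u 0 ^ 2 < 0) :
    (∃ σ A α β m : ℝ, (σ = 1 ∨ σ = -1) ∧ 0 < A ∧ 0 < α ∧ 0 < m ∧ m < 1 ∧
      A ^ 2 = 4 * α ^ 2 ∧ 2 * lam = A ^ 2 * (2 - m) ∧
      ∀ s ∈ Set.Icc 0 L, u s = σ * (A * jacobiDn (α * s + β) m)) ∨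
    (∃ σ : ℝ, (σ = 1 ∨ σ = -1) ∧ 0 < lam ∧ ∀ s ∈ Set.Icc 0 L, u s = σ * Real.sqrt lam) := by
  obtain ⟨σ, hσ, hux⟩ := exists_sign_mul_abs (u 0)
  have hσ2 := sign_sq hσ
  -- For `lam ≤ 0` every term of the energy would be nonnegative.
  have hlam : 0 < lam := by
    by_contra hneg
    nlinarith [mul_nonneg (neg_nonneg.2 (not_lt.1 hneg)) (sq_nonneg (u 0)), sq_nonneg (v 0),
      sq_nonneg (u 0 ^ 2)]
  have hDsq : 0 ≤ lam ^ 2 + (4 * v 0 ^ 2 + u 0 ^ 4 - 2 * lam * u 0 ^ 2) := by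
    nlinarith [sq_nonneg (u 0 ^ 2 - lam), sq_nonneg (v 0)]
  obtain ⟨D, hD0, hD⟩ : ∃ D, 0 ≤ D ∧
      D ^ 2 = lam ^ 2 + (4 * v 0 ^ 2 + u 0 ^ 4 - 2 * lam * u 0 ^ 2) :=
    ⟨_, Real.sqrt_nonneg _, Real.sq_sqrt hDsq⟩
  have hDlam : D < lam := lt_of_pow_lt_pow_left₀ 2 hlam.le (by linarith)
  obtain ⟨hr1, hr2⟩ := abs_le_of_sq_le_sq' (by nlinarith [sq_nonneg (v 0)] :
    (u 0 ^ 2 - lam) ^ 2 ≤ D ^ 2) hD0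
  -- The two turning values `lam ± D` of `u²` coincide exactly when `D = 0`, the constant solution.
  rcases hD0.eq_or_lt with rfl | hDpos
  · right
    have hu2 : |u 0| = Real.sqrt lam := by
      rw [← Real.sqrt_sq_eq_abs]
      congr 1
      linarith
    have hv : v 0 = 0 := pow_eq_zero_iff two_ne_zero |>.1 <| by
      nlinarith [sq_nonneg (u 0 ^ 2 - lam), sq_nonneg (v 0)]
    refine ⟨σ, hσ, hlam, h.eqOn (isCurvatureSol_const ?_ _) (by rw [hux, hu2]) hv⟩
    have := Real.sq_sqrt hlam.le
    linear_combination (-σ * Real.sqrt lam * σ ^ 2) * this - lam * σ * Real.sqrt lam * hσ2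
  · left
    -- Here `A² = lam + D` is the maximum of `u²`, and the minimum `A² (1 - m)` must equal `lam -
    -- D`, whence `m = 2D / (lam + D)`.
    have hA2 : Real.sqrt (lam + D) ^ 2 = lam + D := Real.sq_sqrt (by linarith)
    have hα2 : Real.sqrt ((lam + D) / 4) ^ 2 = (lam + D) / 4 := Real.sq_sqrt (by linarith)
    have hA0 : 0 < Real.sqrt (lam + D) := Real.sqrt_pos.2 (by linarith)
    have hα0 : 0 < Real.sqrt ((lam + D) / 4) := Real.sqrt_pos.2 (by linarith)
    have hm0 : 0 < 2 * D / (lam + D) := div_pos (by linarith) (by linarith)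
    have hm1 : 2 * D / (lam + D) < 1 := (div_lt_one (by linarith)).2 (by linarith)
    have hA : Real.sqrt (lam + D) ^ 2 = 4 * Real.sqrt ((lam + D) / 4) ^ 2 := by
      rw [hA2, hα2]
      ring
    have hsum : lam + D ≠ 0 := by linarith
    have hlamA : 2 * lam = Real.sqrt (lam + D) ^ 2 * (2 - 2 * D / (lam + D)) := by
      rw [hA2]
      field_simp
      ring
    have hlow : (lam + D) * (1 - 2 * D / (lam + D)) = lam - D := by
      field_simp
      ring
    obtain ⟨β, hβ, hβ'⟩ := exists_phase_dn (x := |u 0|) (y := σ * v 0) hA0 hm0 hm1 hA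
      (by rw [sq_abs]; linarith) (by rw [sq_abs, hA2, hlow]; linarith) (abs_nonneg _)
      (by rw [sq_abs, hA2, hlow]; linear_combination 4 * v 0 ^ 2 * hσ2 - hD)
    refine ⟨σ, _, _, β, _, hσ, hA0, hα0, hm0, hm1, hA, hlamA,
      h.eqOn (isCurvatureSol_dn hσ2 hm0 hm1 hA hlamA β _) ?_ ?_⟩
    · simpa [hβ] using hux
    · simp only [mul_zero, zero_add]
      linear_combination -σ * hβ' - v 0 * hσ2

/-! ### The curvature of an elastica -/

section Arclength

variable {n : ℕ} {γ : ℝ → EuclideanSpace ℝ (Fin n)} {a b : ℝ}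

lemma IsArclength.arcIter_succ (harc : IsArclength γ a b) (j : ℕ) {x : ℝ}
    (hx : x ∈ Set.Icc a b) :
    arcIter γ a b (j + 1) x = derivWithin (arcIter γ a b j) (Set.Icc a b) x := by
  rw [arcIter, Function.iterate_succ_apply', arcDeriv, harc x hx, inv_one, one_smul]
  rfl

lemma IsArclength.contDiffOn_arcIter (harc : IsArclength γ a b) (hab : a < b)
    (hγ : ContDiffOn ℝ ∞ γ (Set.Icc a b)) (j : ℕ) :
    ContDiffOn ℝ ∞ (arcIter γ a b j) (Set.Icc a b) := by
  induction j with
  | zero => exact hγ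
  | succ j ih =>
    exact (ih.derivWithin (uniqueDiffOn_Icc hab) le_rfl).congr
      fun x hx => harc.arcIter_succ j hx

lemma IsArclength.hasDerivWithinAt_arcIter (harc : IsArclength γ a b) (hab : a < b)
    (hγ : ContDiffOn ℝ ∞ γ (Set.Icc a b)) (j : ℕ) {x : ℝ} (hx : x ∈ Set.Icc a b) (i : Fin n) :
    HasDerivWithinAt (fun x => arcIter γ a b j x i) (arcIter γ a b (j + 1) x i)
      (Set.Icc a b) x := by
  have h := ((harc.contDiffOn_arcIter hab hγ j).differentiableOn (by simp) x hx).hasDerivWithinAt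
  rw [← harc.arcIter_succ j hx] at h
  exact (EuclideanSpace.proj (𝕜 := ℝ) i).hasFDerivAt.comp_hasDerivWithinAt x h

end Arclength

lemma eq_zero_of_hasDerivWithinAt_const {a b c d x : ℝ} (hab : a < b) {f : ℝ → ℝ}
    (hf : ∀ x ∈ Set.Icc a b, f x = c) (hx : x ∈ Set.Icc a b)
    (hd : HasDerivWithinAt f d (Set.Icc a b) x) : d = 0 :=
  (uniqueDiffOn_Icc hab x hx).eq_deriv _ hd
    ((hasDerivWithinAt_const x (Set.Icc a b) c).congr hf (hf x hx))

lemma signedCurvature_eq (γ : ℝ → EuclideanSpace ℝ (Fin 2)) (a b : ℝ) :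
    signedCurvature γ a b = fun x =>
      arcIter γ a b 2 x 1 * arcIter γ a b 1 x 0 - arcIter γ a b 2 x 0 * arcIter γ a b 1 x 1 := by
  ext x
  simp [signedCurvature, rotQuarter, PiLp.inner_apply, Fin.sum_univ_two]
  ring

/-- With `N_s = -k γ_s` and `⟨γ_sss, γ_s⟩ = -k²`, one gets `k'' = ⟨γ_ssss, N⟩ + k³`. The normal part
of the elastica equation is `2⟨γ_ssss, N⟩ = lam k - 3k³`. -/
lemma IsElastica.isCurvatureSol {lam a b : ℝ} (hab : a < b) {γ : ℝ → EuclideanSpace ℝ (Fin 2)}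
    (hγ : IsElastica lam γ a b) (harc : IsArclength γ a b) :
    IsCurvatureSol lam (signedCurvature γ a b)
      (fun x => arcIter γ a b 3 x 1 * arcIter γ a b 1 x 0 -
        arcIter γ a b 3 x 0 * arcIter γ a b 1 x 1) (Set.Icc a b) := by
  have hd (j : ℕ) (i : Fin 2) {x : ℝ} (hx : x ∈ Set.Icc a b) :=
    harc.hasDerivWithinAt_arcIter hab hγ.smooth.contDiffOn j hx i
  have hunit : ∀ x ∈ Set.Icc a b,
      arcIter γ a b 1 x 0 ^ 2 + arcIter γ a b 1 x 1 ^ 2 = 1 := fun x hx => by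
    have h := harc x hx
    have h1 : arcIter γ a b 1 x = derivWithin γ (Set.Icc a b) x := harc.arcIter_succ 0 hx
    rw [← h1] at h
    rw [← Fin.sum_univ_two (fun i => arcIter γ a b 1 x i ^ 2),
      ← EuclideanSpace.real_norm_sq_eq, h, one_pow]
  have horth : ∀ x ∈ Set.Icc a b, arcIter γ a b 1 x 0 * arcIter γ a b 2 x 0 +
      arcIter γ a b 1 x 1 * arcIter γ a b 2 x 1 = 0 := fun x hx => by
    have h := eq_zero_of_hasDerivWithinAt_const hab hunit hx
      (((hd 1 0 hx).fun_pow 2).fun_add ((hd 1 1 hx).fun_pow 2))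
    norm_num at h
    linarith
  have horth' : ∀ x ∈ Set.Icc a b,
      arcIter γ a b 2 x 0 ^ 2 + arcIter γ a b 2 x 1 ^ 2 +
      (arcIter γ a b 1 x 0 * arcIter γ a b 3 x 0 +
        arcIter γ a b 1 x 1 * arcIter γ a b 3 x 1) = 0 := fun x hx => by
    have h := eq_zero_of_hasDerivWithinAt_const hab horth hx
      (((hd 1 0 hx).fun_mul (hd 2 0 hx)).fun_add ((hd 1 1 hx).fun_mul (hd 2 1 hx)))
    norm_num at h
    linarith
  rw [signedCurvature_eq]
  refine ⟨fun x hx => ?_, fun x hx => ?_⟩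
  · refine (((hd 2 1 hx).fun_mul (hd 1 0 hx)).fun_sub
      ((hd 2 0 hx).fun_mul (hd 1 1 hx))).congr_deriv ?_
    norm_num
    ring
  · refine (((hd 3 1 hx).fun_mul (hd 1 0 hx)).fun_sub
      ((hd 3 0 hx).fun_mul (hd 1 1 hx))).congr_deriv ?_
    have heq := hγ.equation x hx
    have he0 := congrArg (fun w : EuclideanSpace ℝ (Fin 2) => w 0) heq
    have he1 := congrArg (fun w : EuclideanSpace ℝ (Fin 2) => w 1) heq
    have h1 := hunit x hx
    have h2 := horth x hx
    have h3 := horth' x hx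
    simp only [EuclideanSpace.real_norm_sq_eq, PiLp.add_apply, PiLp.sub_apply, PiLp.smul_apply,
      PiLp.zero_apply, smul_eq_mul, Fin.sum_univ_two] at he0 he1
    norm_num only
    clear heq hd hunit horth horth'
    -- The value of this inner product is irrelevant: it multiplies `γ_s`, which is orthogonal to
    -- `N`.
    generalize inner ℝ (arcIter γ a b 2 x) (arcIter γ a b 3 x) = I at *
    generalize arcIter γ a b 1 x 0 = p1 at *
    generalize arcIter γ a b 1 x 1 = q1 at *
    generalize arcIter γ a b 2 x 0 = p2 at *
    generalize arcIter γ a b 2 x 1 = q2 at *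
    generalize arcIter γ a b 3 x 0 = p3 at *
    generalize arcIter γ a b 3 x 1 = q3 at *
    generalize arcIter γ a b 4 x 0 = p4 at *
    generalize arcIter γ a b 4 x 1 = q4 at *
    set k := q2 * p1 - p2 * q1 with hk
    -- These two identities are the Frenet equation `γ_ss = k N`.
    have hp2 : p2 = -k * q1 := by linear_combination (-p2) * h1 + p1 * h2
    have hq2 : q2 = k * p1 := by linear_combination (-q2) * h1 + q1 * h2
    have hkk : k ^ 2 = p2 ^ 2 + q2 ^ 2 := by
      linear_combination (p2 ^ 2 + q2 ^ 2) * h1 - (p1 * p2 + q1 * q2) * h2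
    -- The left side is `⟨γ_sss, N_s⟩`.
    have hdet : q3 * p2 - p3 * q2 = k ^ 3 := by
      linear_combination q3 * hp2 - p3 * hq2 - k * h3 - k * hkk
    linear_combination p1 / 2 * he1 - q1 / 2 * he0 + hdet + 3 / 2 * k * hkk

theorem theorem2p10 (lam L : ℝ) (hL : 0 < L) (γ : ℝ → EuclideanSpace ℝ (Fin 2))
    (hγ : IsElastica lam γ 0 L) (harc : IsArclength γ 0 L) :
    (∀ s ∈ Set.Icc 0 L, signedCurvature γ 0 L s = 0) ∨
    (∃ σ A α β m : ℝ, (σ = 1 ∨ σ = -1) ∧ 0 < A ∧ 0 < α ∧ 0 < m ∧ m < 1 ∧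
      A ^ 2 = 4 * α ^ 2 * m ∧ 2 * m * lam = A ^ 2 * (2 * m - 1) ∧
      ∀ s ∈ Set.Icc 0 L, signedCurvature γ 0 L s = σ * (A * jacobiCn (α * s + β) m)) ∨
    (∃ σ A α β : ℝ, (σ = 1 ∨ σ = -1) ∧ 0 < A ∧ 0 < α ∧
      A ^ 2 = 4 * α ^ 2 ∧ A ^ 2 = 2 * lam ∧
      ∀ s ∈ Set.Icc 0 L, signedCurvature γ 0 L s = σ * (A * hypSech (α * s + β))) ∨
    (∃ σ A α β m : ℝ, (σ = 1 ∨ σ = -1) ∧ 0 < A ∧ 0 < α ∧ 0 < m ∧ m < 1 ∧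
      A ^ 2 = 4 * α ^ 2 ∧ 2 * lam = A ^ 2 * (2 - m) ∧
      ∀ s ∈ Set.Icc 0 L, signedCurvature γ 0 L s = σ * (A * jacobiDn (α * s + β) m)) ∨
    (∃ σ : ℝ, (σ = 1 ∨ σ = -1) ∧ 0 < lam ∧
      ∀ s ∈ Set.Icc 0 L, signedCurvature γ 0 L s = σ * Real.sqrt lam) := by
  have h := hγ.isCurvatureSol hL harc
  generalize signedCurvature γ 0 L = k at h ⊢
  obtain ⟨v, h⟩ : ∃ v, IsCurvatureSol lam k v (Set.Icc 0 L) := ⟨_, h⟩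
  rcases lt_trichotomy (4 * v 0 ^ 2 + k 0 ^ 4 - 2 * lam * k 0 ^ 2) 0 with hC | hC | hC
  · exact Or.inr (Or.inr (Or.inr (h.exists_dn hC)))
  · by_cases hk : k 0 = 0
    -- Zero energy with `k 0 = 0` forces `v 0 = 0`, so `k` agrees with the zero solution.
    · refine Or.inl (h.eqOn (isCurvatureSol_const (by ring) _) hk ?_)
      simpa [hk] using hC
    · exact Or.inr (Or.inr (Or.inl (h.exists_sech hC hk)))
  · obtain ⟨A, α, β, m, hA0, hα0, hm0, hm1, hA, hlam, hk⟩ := h.exists_cn hC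
    -- The sign `1` suffices, since `cn` itself takes both signs.
    exact Or.inr (Or.inl ⟨1, A, α, β, m, Or.inl rfl, hA0, hα0, hm0, hm1, hA, hlam,
      fun s hs => by rw [one_mul, hk s hs]⟩)
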